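/- A mixed multigraph is a finite multigraph in which each edge is either undirected or directed. Walks traverse directed edges only along their direction; a path is a walk without repeated edges and without repeated vertices, except that its first and last vertex may coincide, and a cycle is a path of positive length whose first and last vertex coincide. $G$ is strongly connected if there is a path from each vertex to every other vertex; a bridge is an undirected edge whose removal disconnects the underlying undirected multigraph. Let $d_G(u,v)$ be the length of a shortest path from $u$ to $v$ ($\infty$ if there is none). The radius of $G$ is $\min_u\max_v\max\{d_G(u,v),d_G(v,u)\}$, and the oriented radius of $G$ is the minimum radius of a digraph obtained from $G$ by giving each undirected edge exactly one direction. Theorem. Let $G$ be a strongly connected bridgeless mixed multigraph of radius $r\ge 1$. Then there is an integer $k$ such that every edge of $G$ belongs to a cycle of length at most $k$; let $\eta$ denote the smallest such $k$. The oriented radius of $G$ is finite and at most $$1.5\,r\eta-0.375(\eta-1)(\eta-3)-2r+1\;\le\;1.5\,r\eta .$$ -/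

import Mathlib

/-- A mixed multigraph with vertex set `V` and edge set `E`: every edge is either undirected
(`Sum.inl s(u, v)`, joining `u` and `v`) or directed (`Sum.inr (u, v)`, from `u` to `v`).
Parallel edges and loops are allowed. -/
structure MixedMultigraph (V E : Type*) where
  edge : E → Sym2 V ⊕ V × V

namespace MixedMultigraph

variable {V E : Type*}

/-- The edge `e` can be traversed from `u` to `v`: it is an undirected edge joining `u` and `v`,
or a directed edge from `u` to `v`. -/
def Traverses (G : MixedMultigraph V E) (e : E) (u v : V) : Prop :=
  G.edge e = Sum.inl s(u, v) ∨ G.edge e = Sum.inr (u, v)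

/-- Walks from one vertex to another, recorded with the edges that they use. -/
inductive Walk (G : MixedMultigraph V E) : V → V → Type _
  | nil (u : V) : Walk G u u
  | cons {u v w : V} (e : E) (h : G.Traverses e u v) (p : Walk G v w) : Walk G u w

namespace Walk

variable {G : MixedMultigraph V E}

/-- The number of edges of a walk. -/
def length : {u v : V} → G.Walk u v → ℕ
  | _, _, nil _ => 0
  | _, _, cons _ _ p => p.length + 1

/-- The edges of a walk, in order. -/
def edges : {u v : V} → G.Walk u v → List E
  | _, _, nil _ => []
  | _, _, cons e _ p => e :: p.edges

/-- The vertices of a walk, in order, with both end vertices. -/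
def support : {u v : V} → G.Walk u v → List V
  | _, _, nil u => [u]
  | u, _, cons _ _ p => u :: p.support

/-- A trail is a walk without repeated edges. -/
def IsTrail {u v : V} (p : G.Walk u v) : Prop :=
  p.edges.Nodup

/-- A path is a trail without repeated vertices, except that its first and its last vertex may
coincide. -/
def IsPath {u v : V} (p : G.Walk u v) : Prop :=
  p.IsTrail ∧ p.support.dropLast.Nodup ∧ p.support.tail.Nodup

/-- A cycle is a closed path with at least one edge. -/
def IsCycle {u : V} (p : G.Walk u u) : Prop :=
  p.IsPath ∧ 0 < p.length

end Walk

/-- There is a path from each vertex to every other vertex. -/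
def StronglyConnected (G : MixedMultigraph V E) : Prop :=
  ∀ u v : V, u ≠ v → ∃ p : G.Walk u v, p.IsPath

/-- The underlying undirected multigraph. -/
def underlying (G : MixedMultigraph V E) : MixedMultigraph V E where
  edge e := match G.edge e with
    | Sum.inl s => Sum.inl s
    | Sum.inr a => Sum.inl s(a.1, a.2)

/-- Removal of the edge `e`. -/
def deleteEdge (G : MixedMultigraph V E) (e : E) : MixedMultigraph V {f : E // f ≠ e} where
  edge f := G.edge f.1

/-- A bridge is an undirected edge whose removal disconnects the graph, i.e. leaves a graph
whose underlying undirected multigraph is not connected. -/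
def IsBridge (G : MixedMultigraph V E) (e : E) : Prop :=
  (∃ s : Sym2 V, G.edge e = Sum.inl s) ∧ ¬ (G.deleteEdge e).underlying.StronglyConnected

/-- No edge is a bridge. -/
def Bridgeless (G : MixedMultigraph V E) : Prop :=
  ∀ e : E, ¬ G.IsBridge e

/-- The length of a shortest path from `u` to `v` (`⊤` if there is none). -/
noncomputable def dist (G : MixedMultigraph V E) (u v : V) : ℕ∞ :=
  ⨅ p : {p : G.Walk u v // p.IsPath}, (p.1.length : ℕ∞)

/-- The largest distance from `u` to a vertex. -/
noncomputable def outEccentricity (G : MixedMultigraph V E) (u : V) : ℕ∞ :=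
  ⨆ v : V, G.dist u v

/-- The largest distance from a vertex to `u`. -/
noncomputable def inEccentricity (G : MixedMultigraph V E) (u : V) : ℕ∞ :=
  ⨆ v : V, G.dist v u

/-- The eccentricity of a vertex. -/
noncomputable def eccentricity (G : MixedMultigraph V E) (u : V) : ℕ∞ :=
  max (G.outEccentricity u) (G.inEccentricity u)

/-- The smallest eccentricity of a vertex. -/
noncomputable def radius (G : MixedMultigraph V E) : ℕ∞ :=
  ⨅ u : V, G.eccentricity u

/-- `D` is an orientation of `G`: every edge of `D` is directed, an undirected edge of `G` has
received one of its two directions, and a directed edge of `G` has kept its direction. -/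
def IsOrientation (D G : MixedMultigraph V E) : Prop :=
  ∀ e : E, ∃ u v : V, D.edge e = Sum.inr (u, v) ∧ G.Traverses e u v

/-- The smallest radius of an orientation. -/
noncomputable def orientedRadius (G : MixedMultigraph V E) : ℕ∞ :=
  ⨅ D : {D : MixedMultigraph V E // D.IsOrientation G}, D.1.radius

/-- Every edge belongs to a cycle of length at most `k`. -/
def EveryEdgeOnCycle (G : MixedMultigraph V E) (k : ℕ) : Prop :=
  ∀ e : E, ∃ (u : V) (c : G.Walk u u), c.IsCycle ∧ e ∈ c.edges ∧ c.length ≤ k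

/-- The smallest `k` such that every edge belongs to a cycle of length at most `k`. -/
noncomputable def eta (G : MixedMultigraph V E) : ℕ :=
  sInf {k : ℕ | G.EveryEdgeOnCycle k}

end MixedMultigraph

/-! The proof is an induction on the radius. Put `m = η - 1`, so that every edge closes up in at
most `m` further steps, and let `u` be a centre. `exists_rootedOrientation_neighbors` orients edges
on a set `W` that contains `u` and all its neighbours, with distances at most `m` in one direction
and `2 * m - 1` in the other. Collapsing `W` to a point lowers the eccentricity bound of `u` by one
and preserves both the cycle bound and the cut condition that encodes bridgelessness. An orientation
of the quotient lifts back, and the distances add up (`IsRootedOrientation.lift_collapse`).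

Two refinements give the constants. When the eccentricity is at most `j`, every edge closes up in `2
* j` steps (`onCycle_of_eccentricity`), so a stage costs only `3 * min m (2 * j) - 1` in total.
Reversing all edges swaps the two distance bounds, so the stages can be directed to keep the out-
and in-totals within 2 of each other (`exists_rootedOrientation`). The oriented radius is then at
most half the sum of the stage costs plus 1, and `sum_min_le` estimates that sum. -/

namespace MixedMultigraph

/-! ### Walks of bounded length for a relation -/

/-- `Within R n x y`: there is an `R`-walk with at most `n` steps from `x` to `y`. -/
inductive Within {V : Type*} (R : V → V → Prop) : ℕ → V → V → Prop
  | refl (n : ℕ) (x : V) : Within R n x x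
  | step {n : ℕ} {x y z : V} (h : R x y) (p : Within R n y z) : Within R (n + 1) x z

namespace Within

variable {V V' : Type*} {R R' : V → V → Prop} {m n : ℕ} {x y z : V}

theorem mono (h : Within R n x y) (hn : n ≤ m) : Within R m x y := by
  induction h generalizing m with
  | refl n x => exact .refl m x
  | step h _ ih =>
    obtain ⟨k, rfl⟩ : ∃ k, m = k + 1 := ⟨m - 1, by omega⟩
    exact .step h (ih (by omega))

theorem map {R' : V' → V' → Prop} (f : V → V') (hf : ∀ a b, R a b → R' (f a) (f b))
    (h : Within R n x y) : Within R' n (f x) (f y) := by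
  induction h with
  | refl n x => exact .refl n _
  | step h _ ih => exact .step (hf _ _ h) ih

theorem weaken (h : Within R n x y) (hR : ∀ a b, R a b → R' a b) : Within R' n x y :=
  h.map id hR

theorem single (h : R x y) : Within R 1 x y := .step h (.refl 0 y)

theorem trans (h : Within R m x y) (h' : Within R n y z) : Within R (m + n) x z := by
  induction h with
  | refl k x => exact h'.mono (by omega)
  | @step k a b c h _ ih =>
    rw [Nat.add_right_comm]
    exact .step h (ih h')

theorem snoc (h : Within R n x y) (h' : R y z) : Within R (n + 1) x z := h.trans (single h')

theorem flip (h : Within R n x y) : Within (fun a b => R b a) n y x := by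
  induction h with
  | refl n x => exact .refl n x
  | step h _ ih => exact ih.snoc h

theorem eq_of_zero (h : Within R 0 x y) : x = y := by
  cases h; rfl

theorem cases_tail (h : Within R (n + 1) x z) : x = z ∨ ∃ y, Within R n x y ∧ R y z := by
  have h' := h.flip
  cases h' with
  | refl => exact .inl rfl
  | step h p => exact .inr ⟨_, p.flip, h⟩

/-- A walk to `z` can be stopped at its first visit to `z`. -/
theorem avoid_target (h : Within R n x z) : Within (fun a b => R a b ∧ a ≠ z) n x z := by
  induction h with
  | refl n x => exact .refl n x
  | @step k a b c h _ ih =>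
    by_cases hac : a = c
    · exact hac ▸ .refl _ _
    · exact .step ⟨h, hac⟩ ih

theorem avoid_source (h : Within R n x z) : Within (fun a b => R a b ∧ b ≠ x) n x z :=
  h.flip.avoid_target.flip

/-- A walk to `u ∈ W` first meets `W` either outside `u`, or at `u`. -/
theorem first_hit {W : Set V} {b u : V} (h : Within R n b u) (hb : b ∉ W) (hu : u ∈ W) :
    (∃ a ∈ W, a ≠ u ∧ ∃ k, k + 1 ≤ n ∧ Within (fun c d => R c d ∧ c ∉ W ∧ d ≠ u) k b a) ∨
      Within (fun c d => R c d ∧ c ∉ W ∧ (d ∉ W ∨ d = u)) n b u := by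
  induction h with
  | refl n x => exact absurd hu hb
  | @step n x y z h p ih =>
    by_cases hyz : y = z
    · subst hyz
      exact .inr ((single ⟨h, hb, .inr rfl⟩).mono (by omega))
    by_cases hy : y ∈ W
    -- At least one more step is needed from `y` to `z ≠ y`, hence `k + 1 ≤ n`.
    · refine .inl ⟨y, hy, hyz, 1, ?_, single ⟨h, hb, hyz⟩⟩
      rcases n with _ | n
      · exact absurd p.eq_of_zero hyz
      · omega
    · rcases ih hy hu with ⟨a, ha, hau, k, hk, q⟩ | q
      · exact .inl ⟨a, ha, hau, k + 1, by omega, .step ⟨h, hb, hyz⟩ q⟩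
      · exact .inr (.step ⟨h, hb, .inl hy⟩ q)

end Within

/-! ### Families of darts and unions of geodesics -/

/-- The step relation of a family `T` of darts: `T e x y` says that `e` leads from `x` to `y`. -/
def Adj {V E : Type*} (T : E → V → V → Prop) (x y : V) : Prop := ∃ e, T e x y

/-- The darts of `T` that do not belong to the edge `e`. -/
def Avoid {V E : Type*} (T : E → V → V → Prop) (e : E) : E → V → V → Prop :=
  fun f x y => T f x y ∧ f ≠ e

/-- The reversed darts. -/
def Flip {V E : Type*} (T : E → V → V → Prop) : E → V → V → Prop := fun e x y => T e y x

/-- All darts of an edge have the same two ends. -/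
def Ends {V E : Type*} (T : E → V → V → Prop) : Prop :=
  ∀ e x y x' y', T e x y → T e x' y' → (x' = x ∧ y' = y) ∨ (x' = y ∧ y' = x)

/-- The edge `e` lies on a closed walk that uses it once and has at most `m` further steps. -/
def OnCycle {V E : Type*} (T : E → V → V → Prop) (m : ℕ) (e : E) : Prop :=
  ∃ x y, T e x y ∧ Within (Adj (Avoid T e)) m y x

section Darts

variable {V E : Type*} {T : E → V → V → Prop} {m : ℕ}

theorem Within.adj_mono {T' : E → V → V → Prop} {n : ℕ} {x y : V} (h : Within (Adj T) n x y)
    (hT : ∀ e a b, T e a b → T' e a b) : Within (Adj T') n x y :=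
  h.weaken fun _ _ ⟨e, he⟩ => ⟨e, hT _ _ _ he⟩

theorem Ends.flip (h : Ends T) : Ends (Flip T) := by
  intro e x y x' y' h1 h2
  have := h e _ _ _ _ h1 h2
  tauto

theorem OnCycle.flip {e : E} (h : OnCycle T m e) : OnCycle (Flip T) m e := by
  obtain ⟨x, y, h, p⟩ := h
  exact ⟨y, x, h, p.flip⟩

/-- The union of the shortest walks from a set `A` to the vertices of a set `B`. -/
theorem exists_geodesic_hull (S : E → V → V → Prop) (A B : Set V) (n : ℕ)
    (hB : ∀ b ∈ B, ∃ a ∈ A, Within (Adj S) n a b) :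
    ∃ (O : E → V → V → Prop) (N : Set V) (D : V → ℕ),
      (∀ e x y, O e x y → S e x y ∧ x ∈ N ∧ y ∈ N ∧ D y = D x + 1) ∧ B ⊆ N ∧ (∀ a ∈ A, D a = 0) ∧
      ∀ x ∈ N, (D x = 0 → x ∈ A) ∧ (∃ a ∈ A, Within (Adj O) (D x) a x) ∧
        ∃ b ∈ B, ∃ k, D x + k ≤ n ∧ Within (Adj O) k x b := by
  classical
  set D : V → ℕ := fun x => sInf {k | ∃ a ∈ A, Within (Adj S) k a x} with hD
  have hle : ∀ {k a x}, a ∈ A → Within (Adj S) k a x → D x ≤ k :=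
    fun ha h => Nat.sInf_le ⟨_, ha, h⟩
  have hmem : ∀ {k a x}, a ∈ A → Within (Adj S) k a x → ∃ a ∈ A, Within (Adj S) (D x) a x :=
    fun {k a x} ha h => Nat.sInf_mem (s := {k | ∃ a ∈ A, Within (Adj S) k a x}) ⟨k, a, ha, h⟩
  set N : Set V := {x | (∃ a ∈ A, Within (Adj S) (D x) a x) ∧
    ∃ b ∈ B, ∃ k, D b = D x + k ∧ Within (Adj S) k x b} with hN
  -- `D` rises by one along every dart of `O`, so no edge is used in both directions.
  set O : E → V → V → Prop := fun e x y => S e x y ∧ x ∈ N ∧ y ∈ N ∧ D y = D x + 1 with hO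
  have fwd : ∀ k x b, Within (Adj S) k x b → b ∈ B → x ∈ N → D b = D x + k →
      Within (Adj O) k x b := by
    intro k x b h
    induction h with
    | refl k x => intros; exact .refl _ _
    | @step k x y b h p ih =>
      intro hb hx hk
      obtain ⟨a, ha, hax⟩ := hx.1
      -- `D y ≤ D x + 1` and `D b ≤ D y + k` together force `D y = D x + 1`.
      have hay := hax.snoc h
      have h1 := hle ha hay
      obtain ⟨a', ha', hay'⟩ := hmem ha hay
      have h2 := hle ha' (hay'.trans p)
      have hy : y ∈ N := ⟨⟨a', ha', hay'⟩, b, hb, k, by omega, p⟩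
      obtain ⟨e, he⟩ := h
      exact .step ⟨e, he, hx, hy, by omega⟩ (ih hb hy (by omega))
  have bwd : ∀ k x, D x = k → x ∈ N → ∃ a ∈ A, Within (Adj O) k a x := by
    intro k
    induction k with
    | zero =>
      intro x hx hxN
      obtain ⟨a, ha, hax⟩ := hxN.1
      rw [hx] at hax
      obtain rfl := hax.eq_of_zero
      exact ⟨a, ha, .refl _ _⟩
    | succ k ih =>
      intro x hx hxN
      obtain ⟨a, ha, hax⟩ := hxN.1
      rw [hx] at hax
      rcases hax.cases_tail with rfl | ⟨y, hay, e, he⟩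
      · have := hle ha (Within.refl (R := Adj S) 0 a)
        omega
      · obtain ⟨a', ha', hay'⟩ := hmem ha hay
        have h1 := hle ha hay
        have h2 := hle ha' (hay'.snoc ⟨e, he⟩)
        obtain ⟨b, hb, j, hj, p⟩ := hxN.2
        have hy : y ∈ N := ⟨⟨a', ha', hay'⟩, b, hb, j + 1, by omega, .step ⟨e, he⟩ p⟩
        obtain ⟨a₀, ha₀, q⟩ := ih y (by omega) hy
        exact ⟨a₀, ha₀, q.snoc ⟨e, he, hy, hxN, by omega⟩⟩
  refine ⟨O, N, D, fun e x y h => h, ?_,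
    fun a ha => Nat.le_zero.1 (hle ha (Within.refl (R := Adj S) 0 a)), ?_⟩
  · intro b hb
    obtain ⟨a, ha, p⟩ := hB b hb
    exact ⟨hmem ha p, b, hb, 0, rfl, .refl _ _⟩
  · intro x hx
    refine ⟨fun h0 => ?_, bwd _ x rfl hx, ?_⟩
    · obtain ⟨a, ha, p⟩ := hx.1
      rw [h0] at p
      exact p.eq_of_zero ▸ ha
    · obtain ⟨b, hb, k, hk, p⟩ := hx.2
      obtain ⟨a, ha, q⟩ := hB b hb
      have := hle ha q
      exact ⟨b, hb, k, by omega, fwd k x b p hb hx hk⟩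

/-! ### Orienting a neighbourhood of the root -/

/-- `O` chooses at most one dart for each edge, on the vertex set `W`, so that `W` lies within
out-distance `a` and in-distance `b` of `u`. -/
structure IsRootedOrientation (T O : E → V → V → Prop) (u : V) (a b : ℕ) (W : Set V) : Prop where
  le : ∀ e x y, O e x y → T e x y
  left_mem : ∀ e x y, O e x y → x ∈ W
  right_mem : ∀ e x y, O e x y → y ∈ W
  antisymm : ∀ e x y, O e x y → O e y x → x = y
  root_mem : u ∈ W
  out : ∀ x ∈ W, Within (Adj O) a u x
  into : ∀ x ∈ W, Within (Adj O) b x u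

theorem IsRootedOrientation.flip {O : E → V → V → Prop} {u : V} {a b : ℕ} {W : Set V}
    (h : IsRootedOrientation T O u a b W) : IsRootedOrientation (Flip T) (Flip O) u b a W where
  le e x y := h.le e y x
  left_mem e x y := h.right_mem e y x
  right_mem e x y := h.left_mem e y x
  antisymm e x y h1 h2 := h.antisymm e x y h2 h1
  root_mem := h.root_mem
  out x hx := (h.into x hx).flip
  into x hx := (h.out x hx).flip

/-- The vertices from which there is an edge to `u` that leads only towards `u` are covered by
the geodesics from `u`. -/
theorem exists_rootedOrientation_inNeighbors (u : V)
    (hin : ∀ e v, T e v u → ¬ T e u v → Within (Adj T) m u v) :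
    ∃ O W, IsRootedOrientation T O u m m W ∧ ∀ e v, T e v u → ¬ T e u v → v ∈ W := by
  obtain ⟨O, N, D, hO, hBN, hD0, hN⟩ :=
    exists_geodesic_hull T {u} {v | ∃ e, T e v u ∧ ¬ T e u v} m
      (by rintro b ⟨e, h1, h2⟩; exact ⟨u, rfl, hin e b h1 h2⟩)
  have hD : ∀ x ∈ N, x ≠ u → 1 ≤ D x := fun x hx hxu =>
    Nat.pos_of_ne_zero fun h => hxu ((hN x hx).1 h)
  have hDu : D u = 0 := hD0 u rfl
  refine ⟨fun e x y => O e x y ∨ (y = u ∧ x ∈ N ∧ T e x u ∧ ¬ T e u x), insert u N,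
    ⟨?_, ?_, ?_, ?_, .inl rfl, ?_, ?_⟩, fun e v h1 h2 => .inr (hBN ⟨e, h1, h2⟩)⟩
  · rintro e x y (h | ⟨rfl, _, h, _⟩)
    exacts [(hO _ _ _ h).1, h]
  · rintro e x y (h | ⟨rfl, h, _⟩)
    exacts [.inr (hO _ _ _ h).2.1, .inr h]
  · rintro e x y (h | ⟨rfl, h, _⟩)
    exacts [.inr (hO _ _ _ h).2.2.1, .inl rfl]
  · rintro e x y (h | ⟨rfl, hx, h, hn⟩) (h' | ⟨hu, hx', h', hn'⟩)
    · have := (hO _ _ _ h).2.2.2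
      have := (hO _ _ _ h').2.2.2
      omega
    · subst hu
      exact absurd (hO _ _ _ h).1 hn'
    · exact absurd (hO _ _ _ h').1 hn
    · exact hu
  · rintro x (rfl | hx)
    · exact .refl _ _
    · obtain ⟨-, ⟨a, rfl, p⟩, b, -, k, hk, -⟩ := hN x hx
      exact (p.adj_mono fun _ _ _ h => .inl h).mono (by omega)
  · intro x hx
    by_cases hxu : x = u
    · exact hxu ▸ .refl _ _
    have hx := hx.resolve_left hxu
    obtain ⟨-, -, b, ⟨e, h1, h2⟩, k, hk, p⟩ := hN x hx
    -- `D x ≥ 1` and `D x + k ≤ m` leave room for the closing edge: `k + 1 ≤ m`.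
    have := hD x hx hxu
    exact ((p.adj_mono fun _ _ _ h => .inl h).snoc
      ⟨e, .inr ⟨rfl, hBN ⟨e, h1, h2⟩, h1, h2⟩⟩).mono (by omega)

/-- Enlarging a rooted orientation by the shortest walks back to the root after an edge
`e : u → b`, along new vertices. -/
theorem IsRootedOrientation.add_closed_walk {O : E → V → V → Prop} {u b : V} {W : Set V} {e : E}
    (hW : IsRootedOrientation T O u m m W) (hb : b ∉ W) (he : T e u b)
    (p : Within (fun c d => Adj (Avoid T e) c d ∧ c ∉ W ∧ (d ∉ W ∨ d = u)) m b u) :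
    ∃ O' W', IsRootedOrientation T O' u m m W' ∧ W ⊆ W' ∧ b ∈ W' := by
  -- The steps are reversed, so `D` measures the distance to `u`. Avoiding `e` leaves it free to be
  -- directed from `u` to `b`.
  obtain ⟨P, N, D, hO, hBN, hD0, hN⟩ := exists_geodesic_hull
    (fun f x y => Avoid T e f y x ∧ y ∉ W ∧ (x ∉ W ∨ x = u)) {u} {b} m (by
      rintro _ rfl
      exact ⟨u, rfl, p.flip.weaken fun _ _ ⟨⟨f, hf⟩, h⟩ => ⟨f, hf, h⟩⟩)
  have hD : ∀ x ∈ N, x ∉ W → 1 ≤ D x := fun x hx hxW =>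
    Nat.pos_of_ne_zero fun h => hxW ((hN x hx).1 h ▸ hW.root_mem)
  have hbN : b ∈ N := hBN rfl
  refine ⟨fun f x y => O f x y ∨ P f y x ∨ (f = e ∧ x = u ∧ y = b), W ∪ N,
    ⟨?_, ?_, ?_, ?_, .inl hW.root_mem, ?_, ?_⟩, Set.subset_union_left, .inr hbN⟩
  · rintro f x y (h | h | ⟨rfl, rfl, rfl⟩)
    exacts [hW.le _ _ _ h, (hO _ _ _ h).1.1.1, he]
  · rintro f x y (h | h | ⟨rfl, rfl, rfl⟩)
    exacts [.inl (hW.left_mem _ _ _ h), .inr (hO _ _ _ h).2.2.1, .inl hW.root_mem]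
  · rintro f x y (h | h | ⟨rfl, rfl, rfl⟩)
    exacts [.inl (hW.right_mem _ _ _ h), .inr (hO _ _ _ h).2.1, .inr hbN]
  · rintro f x y (h | h | ⟨rfl, rfl, rfl⟩) (h' | h' | ⟨h1, h2, h3⟩)
    · exact hW.antisymm _ _ _ h h'
    · exact absurd (hW.right_mem _ _ _ h) (hO _ _ _ h').1.2.1
    · exact absurd (h3 ▸ hW.left_mem _ _ _ h) hb
    · exact absurd (hW.right_mem _ _ _ h') (hO _ _ _ h).1.2.1
    · have := (hO _ _ _ h).2.2.2
      have := (hO _ _ _ h').2.2.2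
      omega
    · exact absurd h1 (hO _ _ _ h).1.1.2
    · exact absurd (hW.left_mem _ _ _ h') hb
    · exact absurd rfl (hO _ _ _ h').1.1.2
    · exact h3
  · intro x hx
    by_cases hxW : x ∈ W
    · exact (hW.out x hxW).adj_mono fun _ _ _ h => .inl h
    obtain ⟨-, -, b', rfl, k, hk, q⟩ := hN x (hx.resolve_left hxW)
    have := hD x (hx.resolve_left hxW) hxW
    exact (Within.step ⟨e, .inr (.inr ⟨rfl, rfl, rfl⟩)⟩
      (q.flip.weaken fun _ _ ⟨f, hf⟩ => ⟨f, .inr (.inl hf)⟩)).mono (by omega)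
  · intro x hx
    by_cases hxW : x ∈ W
    · exact (hW.into x hxW).adj_mono fun _ _ _ h => .inl h
    obtain ⟨-, ⟨a, rfl, q⟩, b', -, k, hk, -⟩ := hN x (hx.resolve_left hxW)
    exact (q.flip.weaken fun _ _ ⟨f, hf⟩ => ⟨f, .inr (.inl hf)⟩).mono (by omega)

/-- If every edge leaving `u` returns to `u` within `m` further steps, then a rooted orientation
can be enlarged so that it covers the out-neighbours of `u`. -/
theorem IsRootedOrientation.exists_outNeighbors [Finite V] {O : E → V → V → Prop} {u : V}
    {W : Set V} (hW : IsRootedOrientation T O u m m W) (hm : 1 ≤ m)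
    (hout : ∀ e v, T e u v → Within (Adj (Avoid T e)) m v u) :
    ∃ O' W', IsRootedOrientation T O' u m (2 * m - 1) W' ∧ W ⊆ W' ∧ ∀ e v, T e u v → v ∈ W' := by
  -- By maximality of `W₁`, the return walk from an uncovered out-neighbour meets `W₁` before `u`;
  -- otherwise `add_closed_walk` would enlarge `W₁`.
  obtain ⟨W₁, hWW₁, ⟨⟨O₁, h₁⟩, -⟩, hmax⟩ := Finite.exists_le_maximal
    (p := fun W₁ : Set V => (∃ O₁, IsRootedOrientation T O₁ u m m W₁) ∧ W ⊆ W₁)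
    (a := W) ⟨⟨O, hW⟩, le_rfl⟩
  have hit : ∀ b, b ∉ W₁ → ∀ e, T e u b → ∃ a ∈ W₁, a ≠ u ∧ ∃ k, k + 1 ≤ m ∧
      Within (fun c d => Adj (Avoid T e) c d ∧ c ∉ W₁ ∧ d ≠ u) k b a := by
    intro b hb e he
    rcases (hout e b he).first_hit hb h₁.root_mem with h | h
    · exact h
    · obtain ⟨O₂, W₂, h₂, hsub, hb₂⟩ := h₁.add_closed_walk hb he h
      exact absurd (hmax ⟨⟨O₂, h₂⟩, hWW₁.trans hsub⟩ hsub hb₂) hb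
  -- All uncovered out-neighbours are joined to `W₁ \ {u}` at once, in at most `m - 1` steps; `m`
  -- more lead to `u`, whence `2 * m - 1`. These walks avoid `u`, so the edges from `u` remain free.
  obtain ⟨P, N, D, hO, hBN, hD0, hN⟩ := exists_geodesic_hull
    (fun f x y => T f y x ∧ y ∉ W₁ ∧ x ≠ u) (W₁ \ {u}) {b | b ∉ W₁ ∧ ∃ e, T e u b} (m - 1) (by
      rintro b ⟨hb, e, he⟩
      obtain ⟨a, ha, hau, k, hk, p⟩ := hit b hb e he
      exact ⟨a, ⟨ha, hau⟩, (p.flip.weaken fun _ _ ⟨⟨f, hf⟩, h⟩ => ⟨f, hf.1, h⟩).mono (by omega)⟩)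
  refine ⟨fun f x y => O₁ f x y ∨ P f y x ∨ (x = u ∧ y ∉ W₁ ∧ T f u y), W₁ ∪ N,
    ⟨?_, ?_, ?_, ?_, .inl h₁.root_mem, ?_, ?_⟩, hWW₁.trans Set.subset_union_left, ?_⟩
  · rintro f x y (h | h | ⟨rfl, -, h⟩)
    exacts [h₁.le _ _ _ h, (hO _ _ _ h).1.1, h]
  · rintro f x y (h | h | ⟨rfl, -, -⟩)
    exacts [.inl (h₁.left_mem _ _ _ h), .inr (hO _ _ _ h).2.2.1, .inl h₁.root_mem]
  · rintro f x y (h | h | ⟨rfl, h, h'⟩)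
    exacts [.inl (h₁.right_mem _ _ _ h), .inr (hO _ _ _ h).2.1, .inr (hBN ⟨h, f, h'⟩)]
  · rintro f x y (h | h | ⟨h1, h2, -⟩) (h' | h' | ⟨h1', h2', -⟩)
    · exact h₁.antisymm _ _ _ h h'
    · exact absurd (h₁.right_mem _ _ _ h) (hO _ _ _ h').1.2.1
    · exact absurd (h₁.left_mem _ _ _ h) h2'
    · exact absurd (h₁.right_mem _ _ _ h') (hO _ _ _ h).1.2.1
    · have := (hO _ _ _ h).2.2.2
      have := (hO _ _ _ h').2.2.2
      omega
    · exact absurd h1' (hO _ _ _ h).1.2.2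
    · exact absurd (h₁.left_mem _ _ _ h') h2
    · exact absurd h1 (hO _ _ _ h').1.2.2
    · exact h1.trans h1'.symm
  · intro x hx
    by_cases hxW : x ∈ W₁
    · exact (h₁.out x hxW).adj_mono fun _ _ _ h => .inl h
    obtain ⟨-, -, b, ⟨hb, e, he⟩, k, hk, q⟩ := hN x (hx.resolve_left hxW)
    exact (Within.step ⟨e, .inr (.inr ⟨rfl, hb, he⟩)⟩
      (q.flip.weaken fun _ _ ⟨f, hf⟩ => ⟨f, .inr (.inl hf)⟩)).mono (by omega)
  · intro x hx
    by_cases hxW : x ∈ W₁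
    · exact ((h₁.into x hxW).adj_mono fun _ _ _ h => .inl h).mono (by omega)
    obtain ⟨-, ⟨a, ha, q⟩, b, -, k, hk, -⟩ := hN x (hx.resolve_left hxW)
    exact ((q.flip.weaken fun _ _ ⟨f, hf⟩ => ⟨f, .inr (.inl hf)⟩).trans
      ((h₁.into a ha.1).adj_mono fun _ _ _ h => .inl h)).mono (by omega)
  · intro e v he
    by_cases hv : v ∈ W₁
    exacts [.inl hv, .inr (hBN ⟨hv, e, he⟩)]

/-- If every edge at `u` lies on a cycle of length at most `m + 1`, then `u` and its neighbours
can be covered by a rooted orientation of out-radius `m` and in-radius `2 * m - 1`. -/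
theorem exists_rootedOrientation_neighbors [Finite V] (hT : Ends T) (u : V) (hm : 1 ≤ m)
    (hcyc : ∀ e x y, T e x y → OnCycle T m e) :
    ∃ O W, IsRootedOrientation T O u m (2 * m - 1) W ∧
      ∀ e v, T e u v ∨ T e v u → v ∈ W := by
  -- `T'` drops the outward dart of an edge at `u` unless a short cycle uses the edge in that
  -- direction.
  set T' : E → V → V → Prop := fun e x y =>
    T e x y ∧ (x = u → Within (Adj (Avoid T e)) m y u) with hT'
  have hle : ∀ e x y, T' e x y → T e x y := fun _ _ _ h => h.1
  have hrev : ∀ e v, T e u v → ¬ T' e u v → T e v u ∧ Within (Adj (Avoid T e)) m u v := by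
    intro e v he hn
    obtain ⟨x, y, hxy, p⟩ := hcyc e _ _ he
    rcases hT _ _ _ _ _ he hxy with ⟨rfl, rfl⟩ | ⟨rfl, rfl⟩
    · exact absurd ⟨he, fun _ => p⟩ hn
    · exact ⟨hxy, p⟩
  have hin : ∀ e v, T' e v u → ¬ T' e u v → Within (Adj T') m u v := by
    intro e v he hn
    have hvu : v ≠ u := by
      rintro rfl
      exact hn he
    have p : Within (Adj (Avoid T e)) m u v := by
      obtain ⟨x, y, hxy, p⟩ := hcyc e _ _ he.1
      rcases hT _ _ _ _ _ he.1 hxy with ⟨rfl, rfl⟩ | ⟨rfl, rfl⟩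
      · exact p
      · exact absurd ⟨hxy, fun _ => p⟩ hn
    -- Only the first step `f` leaves `u`, so only `f` could be missing from `T'`. The rest of the
    -- walk followed by `e` returns to `u` without `f`, so `f` is kept.
    have q := p.avoid_source
    cases q with
    | refl => exact absurd rfl hvu
    | @step n _ w _ h q =>
      obtain ⟨⟨f, hf, hfe⟩, hwu⟩ := h
      by_cases hwv : w = v
      · subst hwv
        refine (Within.single ⟨f, hf, fun _ => ?_⟩).mono (by omega)
        exact (Within.single ⟨e, he.1, hfe.symm⟩).mono (by omega)
      have q' : Within (fun a b => Adj T a b ∧ a ≠ u ∧ b ≠ u) n w v := by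
        have : ∀ {k a}, Within (fun a b => Adj (Avoid T e) a b ∧ b ≠ u) k a v → a ≠ u →
            Within (fun a b => Adj T a b ∧ a ≠ u ∧ b ≠ u) k a v := by
          intro k a h
          generalize v = v at h
          induction h with
          | refl => intros; exact .refl _ _
          | step h _ ih => exact fun ha => .step ⟨⟨_, h.1.choose_spec.1⟩, ha, h.2⟩ (ih h.2)
        exact this q hwu
      refine .step ⟨f, hf, fun _ => ?_⟩ ?_
      · refine (q'.weaken ?_).snoc ⟨e, he.1, hfe.symm⟩
        rintro a b ⟨⟨g, hg⟩, ha, hb⟩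
        refine ⟨g, hg, ?_⟩
        rintro rfl
        rcases hT _ _ _ _ _ hf hg with ⟨h, -⟩ | ⟨-, h⟩
        exacts [ha h, hb h]
      · refine q'.weaken ?_
        rintro a b ⟨⟨g, hg⟩, ha, hb⟩
        exact ⟨g, hg, fun h => absurd h ha⟩
  have hout : ∀ e v, T' e u v → Within (Adj (Avoid T' e)) m v u := by
    intro e v he
    -- A walk stopped at its first visit to `u` has no step out of `u`, and elsewhere `T'` agrees
    -- with `T`.
    refine (he.2 rfl).avoid_target.weaken ?_
    rintro a b ⟨⟨f, hf, hfe⟩, ha⟩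
    exact ⟨f, ⟨hf, fun h => absurd h ha⟩, hfe⟩
  obtain ⟨O₁, W₁, h₁, hI⟩ := exists_rootedOrientation_inNeighbors u hin
  obtain ⟨O₂, W₂, h₂, hsub, hN⟩ := h₁.exists_outNeighbors hm hout
  refine ⟨O₂, W₂, { h₂ with le := fun e x y h => hle _ _ _ (h₂.le e x y h) }, ?_⟩
  intro e v h
  by_cases hvu : v = u
  · exact hvu ▸ h₂.root_mem
  by_cases hv : T' e u v
  · exact hN e v hv
  · have hvu' : T e v u := h.elim (fun h => (hrev e v h hv).1) id
    exact hsub (hI e v ⟨hvu', fun h => absurd h hvu⟩ hv)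

end Darts
-- Short cycles from small radius
/-- Every set that separates the ends of an undirected edge is crossed by another edge. -/
def CutConnected {V E : Type*} (T : E → V → V → Prop) : Prop :=
  ∀ e x y, T e x y → T e y x → ∀ A : Set V, x ∈ A → y ∉ A →
    ∃ f, f ≠ e ∧ ∃ a ∈ A, ∃ b ∉ A, T f a b ∨ T f b a

section Darts

variable {V E : Type*} {T : E → V → V → Prop} {m : ℕ}

/-- A walk avoids the edge `e`, or it has a last step along `e`. -/
theorem Within.last_step_along {n : ℕ} {u v : V} (h : Within (Adj T) n u v) (e : E) :
    Within (Adj (Avoid T e)) n u v ∨ ∃ p q i k, T e p q ∧ Within (Adj T) i u p ∧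
      Within (Adj (Avoid T e)) k q v ∧ i + 1 + k ≤ n := by
  induction h with
  | refl n x => exact .inl (.refl _ _)
  | @step n x y z h p ih =>
    rcases ih with q | ⟨p, q, i, k, h1, h2, h3, h4⟩
    · obtain ⟨f, hf⟩ := h
      by_cases hfe : f = e
      · subst hfe
        exact .inr ⟨x, y, 0, n, hf, .refl _ _, q, by omega⟩
      · exact .inl (.step ⟨f, hf, hfe⟩ q)
    · exact .inr ⟨p, q, i + 1, k, h1, .step h h2, h3, by omega⟩

theorem exists_dist (u : V) (hr : ∀ v, ∃ n, Within (Adj T) n u v) :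
    ∃ d : V → ℕ, (∀ v, Within (Adj T) (d v) u v) ∧ ∀ n v, Within (Adj T) n u v → d v ≤ n :=
  ⟨fun v => sInf {n | Within (Adj T) n u v}, fun v => Nat.sInf_mem (hr v),
    fun _ _ h => Nat.sInf_le h⟩

/-- If all the shortest walks from `u` to the end `x` of `e` use `e`, then `e` leads to `x`, its
other end has shortest walks avoiding `e`, and every vertex whose shortest walks use `e` is
reached from `x` without `e`. -/
theorem dist_of_end_forced (hT : Ends T) {u : V} {d : V → ℕ}
    (hd : ∀ v, Within (Adj T) (d v) u v) (hd' : ∀ n v, Within (Adj T) n u v → d v ≤ n)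
    {e : E} {x y : V} (he : T e x y ∨ T e y x)
    (hx : ¬ Within (Adj (Avoid T e)) (d x) u x) :
    T e y x ∧ d x = d y + 1 ∧ Within (Adj (Avoid T e)) (d y) u y ∧
      ∀ v, ¬ Within (Adj (Avoid T e)) (d v) u v →
        ∃ k, d v = d x + k ∧ Within (Adj (Avoid T e)) k x v := by
  have hends : ∀ p q, T e p q → (p = x ∧ q = y) ∨ (p = y ∧ q = x) := by
    intro p q hpq
    rcases he with he | he
    · exact hT _ _ _ _ _ he hpq
    · exact (hT _ _ _ _ _ he hpq).symm
  have hxy : T e y x ∧ d x = d y + 1 := by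
    rcases (hd x).last_step_along e with h | ⟨p, q, i, k, h1, h2, h3, h4⟩
    · exact absurd h hx
    rcases hends p q h1 with ⟨rfl, rfl⟩ | ⟨rfl, rfl⟩
    · have := hd' _ _ h2
      omega
    · have := hd' _ _ h2
      have := hd' _ _ ((hd p).snoc ⟨e, h1⟩)
      exact ⟨h1, by omega⟩
  refine ⟨hxy.1, hxy.2, ?_, fun v hv => ?_⟩
  · rcases (hd y).last_step_along e with h | ⟨p, q, i, k, h1, h2, h3, h4⟩
    · exact h
    rcases hends p q h1 with ⟨rfl, rfl⟩ | ⟨rfl, rfl⟩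
    · have := hd' _ _ h2
      omega
    · have := hd' _ _ h2
      omega
  · rcases (hd v).last_step_along e with h | ⟨p, q, i, k, h1, h2, h3, h4⟩
    · exact absurd h hv
    rcases hends p q h1 with ⟨rfl, rfl⟩ | ⟨rfl, rfl⟩
    · have := hd' _ _ h2
      have := hd' _ _ ((hd q).trans (h3.adj_mono fun _ _ _ h => h.1))
      omega
    · have := hd' _ _ h2
      have := hd' _ _ ((hd q).trans (h3.adj_mono fun _ _ _ h => h.1))
      exact ⟨d v - d q, by omega, h3.mono (by omega)⟩

/-- In a graph of radius at most `r`, every edge that is not a bridge lies on a cycle of length at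
most `2 * r + 1`. -/
theorem onCycle_of_eccentricity (hT : Ends T) (hcut : CutConnected T) {u : V} {r : ℕ}
    (hr : ∀ v, Within (Adj T) r u v ∧ Within (Adj T) r v u) {e : E} {x y : V} (he : T e x y) :
    OnCycle T (2 * r) e := by
  obtain ⟨d, hd, hd'⟩ := exists_dist u fun v => ⟨r, (hr v).1⟩
  obtain ⟨c, hc, hc'⟩ := exists_dist (T := Flip T) u fun v => ⟨r, (hr v).2.flip⟩
  have hdr : ∀ v, d v ≤ r := fun v => hd' _ _ (hr v).1
  have hcr : ∀ v, c v ≤ r := fun v => hc' _ _ (hr v).2.flip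
  -- Main case: all shortest walks from `u` to `x`, and all those from `x` to `u`, use `e`.
  have key : ∀ x y, T e x y → T e y x → ¬ Within (Adj (Avoid T e)) (d x) u x →
      ¬ Within (Adj (Avoid (Flip T) e)) (c x) u x → OnCycle T (2 * r) e := by
    intro x y hxy hyx hA hB
    obtain ⟨-, hdx, py, hAv⟩ := dist_of_end_forced hT hd hd' (.inl hxy) hA
    obtain ⟨-, hcx, qy, hBv⟩ := dist_of_end_forced hT.flip hc hc' (.inl hyx) hB
    have hrx := hdr x
    have hcx' := hcr x
    -- If the vertices forced to use `e` from `u` and those forced to use it towards `u` form the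
    -- same set, another edge `f` crosses that set and closes a cycle. Otherwise a vertex in exactly
    -- one of the two sets takes the place of `f`.
    by_cases hAB : ∀ v, Within (Adj (Avoid T e)) (d v) u v ↔
        Within (Adj (Avoid (Flip T) e)) (c v) u v
    · obtain ⟨f, hfe, a, ha, b, hb, hf⟩ := hcut e x y hxy hyx
        {v | ¬ Within (Adj (Avoid T e)) (d v) u v} hA (fun h => h py)
      have hb : Within (Adj (Avoid T e)) (d b) u b := not_not.1 hb
      have hda := hdr a
      have hca := hcr a
      have hdb := hdr b
      have hcb := hcr b
      rcases hf with hf | hf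
      · obtain ⟨k, hk, p⟩ := hAv a ha
        have q := ((hAB b).1 hb).flip
        exact ⟨y, x, hyx, (((p.snoc ⟨f, hf, hfe⟩).trans q).trans py).mono (by omega)⟩
      · obtain ⟨k, hk, p⟩ := hBv a (fun h => ha ((hAB a).2 h))
        exact ⟨x, y, hxy, ((qy.flip.trans (hb.snoc ⟨f, hf, hfe⟩)).trans p.flip).mono (by omega)⟩
    · push Not at hAB
      obtain ⟨v, ⟨hv, hv'⟩ | ⟨hv, hv'⟩⟩ := hAB
      · obtain ⟨k, hk, p⟩ := hBv v hv'
        have h1 := hdr v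
        have h2 := hcr v
        exact ⟨x, y, hxy, ((qy.flip.trans hv).trans p.flip).mono (by omega)⟩
      · obtain ⟨k, hk, p⟩ := hAv v hv
        have h1 := hdr v
        have h2 := hcr v
        exact ⟨y, x, hyx, ((p.trans hv'.flip).trans py).mono (by omega)⟩
  have close : ∀ x y, T e x y → Within (Adj (Avoid T e)) (d x) u x →
      Within (Adj (Avoid (Flip T) e)) (c y) u y → OnCycle T (2 * r) e := by
    intro x y hxy p q
    have h1 := hdr x
    have h2 := hcr y
    exact ⟨x, y, hxy, (q.flip.trans p).mono (by omega)⟩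
  by_cases hA : Within (Adj (Avoid T e)) (d x) u x
  · by_cases hB : Within (Adj (Avoid (Flip T) e)) (c y) u y
    · exact close x y he hA hB
    · obtain ⟨hyx, -, qx, -⟩ := dist_of_end_forced hT.flip hc hc' (x := y) (y := x) (.inl he) hB
      have hyx : T e y x := hyx
      by_cases hA' : Within (Adj (Avoid T e)) (d y) u y
      · exact close y x hyx hA' qx
      · exact key y x hyx he hA' hB
  · obtain ⟨hyx, -, py, -⟩ := dist_of_end_forced hT hd hd' (.inl he) hA
    by_cases hB : Within (Adj (Avoid (Flip T) e)) (c x) u x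
    · exact close y x hyx py hB
    · exact key x y he hyx hA hB

/-! ### Collapsing a set of vertices -/

/-- The image of a family of darts under a map of the vertices. -/
def Push {V' : Type*} (T : E → V → V → Prop) (f : V → V') : E → V' → V' → Prop :=
  fun e a b => ∃ x y, T e x y ∧ f x = a ∧ f y = b

theorem Ends.push {V' : Type*} (hT : Ends T) (f : V → V') : Ends (Push T f) := by
  rintro e _ _ _ _ ⟨x, y, h, rfl, rfl⟩ ⟨x', y', h', rfl, rfl⟩
  rcases hT _ _ _ _ _ h h' with ⟨rfl, rfl⟩ | ⟨rfl, rfl⟩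
  exacts [.inl ⟨rfl, rfl⟩, .inr ⟨rfl, rfl⟩]

theorem OnCycle.push {V' : Type*} {e : E} (h : OnCycle T m e) (f : V → V') :
    OnCycle (Push T f) m e := by
  obtain ⟨x, y, h, p⟩ := h
  exact ⟨f x, f y, ⟨x, y, h, rfl, rfl⟩,
    p.map f fun a b ⟨g, hg, hge⟩ => ⟨g, ⟨a, b, hg, rfl, rfl⟩, hge⟩⟩

/-- Cuts of the image pull back along `f`. -/
theorem CutConnected.push {V' : Type*} (hT : Ends T) (h : CutConnected T) (f : V → V') :
    CutConnected (Push T f) := by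
  rintro e _ _ ⟨x, y, hxy, rfl, rfl⟩ ⟨x', y', hxy', hx', hy'⟩ A hA hB
  have hyx : T e y x := by
    rcases hT _ _ _ _ _ hxy hxy' with ⟨rfl, rfl⟩ | ⟨rfl, rfl⟩
    · exact absurd (hy' ▸ hA) hB
    · exact hxy'
  obtain ⟨g, hg, a, ha, b, hb, hab⟩ := h e x y hxy hyx (f ⁻¹' A) hA hB
  exact ⟨g, hg, f a, ha, f b, hb,
    hab.imp (fun h => ⟨a, b, h, rfl, rfl⟩) fun h => ⟨b, a, h, rfl, rfl⟩⟩

theorem exists_collapse {V : Type*} (W : Set V) :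
    ∃ f : V → Quot (fun v w => v ∈ W ∧ w ∈ W), Function.Surjective f ∧
      ∀ v w, f v = f w ↔ v = w ∨ (v ∈ W ∧ w ∈ W) := by
  refine ⟨Quot.mk _, Quot.mk_surjective, fun v w => ⟨fun h => ?_, ?_⟩⟩
  · replace h := Quot.eqvGen_exact h
    induction h with
    | rel _ _ h => exact .inr h
    | refl => exact .inl rfl
    | symm a b _ ih =>
      rcases ih with h | h
      exacts [.inl h.symm, .inr h.symm]
    | trans a b c _ _ ih1 ih2 =>
      rcases ih1 with rfl | h
      · exact ih2
      · rcases ih2 with rfl | h'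
        exacts [.inr h, .inr ⟨h.1, h'.2⟩]
  · rintro (rfl | h)
    exacts [rfl, Quot.sound h]

/-- Only the part of a walk after its last visit to the collapsed vertex needs lifting: that part
starts in `W`, where `u` arrives within `a` steps. -/
theorem Within.lift_collapse {V' : Type*} {P : E → V → V → Prop} {O' : E → V' → V' → Prop}
    {W : Set V} {f : V → V'} (hf : ∀ v w, f v = f w ↔ v = w ∨ (v ∈ W ∧ w ∈ W)) {u : V}
    {a : ℕ} (hW : ∀ x ∈ W, Within (Adj P) a u x)
    (hO' : ∀ e a b, O' e a b → Push T f e a b)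
    (hP : ∀ e x y, O' e (f x) (f y) → T e x y → ¬ (x ∈ W ∧ y ∈ W) → P e x y) {n : ℕ} :
    ∀ {v : V}, Within (Adj O') n (f u) (f v) → Within (Adj P) (a + n) u v := by
  induction n with
  | zero =>
    intro v p
    rcases (hf u v).1 p.eq_of_zero with rfl | h
    exacts [.refl _ _, hW v h.2]
  | succ n ih =>
    intro v p
    by_cases hv : v ∈ W
    · exact (hW v hv).mono (by omega)
    rcases p.cases_tail with h | ⟨c, q, e, he⟩
    · rcases (hf u v).1 h with rfl | h
      exacts [.refl _ _, absurd h.2 hv]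
    · obtain ⟨x, y, hxy, rfl, hy⟩ := hO' _ _ _ he
      rcases (hf y v).1 hy with rfl | h
      · exact (ih q).snoc ⟨e, hP _ _ _ he hxy fun h => hv h.2⟩
      · exact absurd h.2 hv

/-- A rooted orientation on `W` and one of the graph with `W` collapsed combine. -/
theorem IsRootedOrientation.lift_collapse {V' : Type*} {O : E → V → V → Prop}
    {O' : E → V' → V' → Prop} {W : Set V} {f : V → V'}
    (hf : ∀ v w, f v = f w ↔ v = w ∨ (v ∈ W ∧ w ∈ W)) {u : V} {a b a' b' : ℕ}
    (h : IsRootedOrientation T O u a b W)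
    (h' : IsRootedOrientation (Push T f) O' (f u) a' b' Set.univ) :
    ∃ P, IsRootedOrientation T P u (a + a') (b + b') Set.univ := by
  -- Edges inside `W` become loops in the quotient, so what `O'` does with them is discarded.
  refine ⟨fun e x y => O e x y ∨ (T e x y ∧ ¬ (x ∈ W ∧ y ∈ W) ∧ O' e (f x) (f y)),
    ⟨?_, fun _ _ _ _ => trivial, fun _ _ _ _ => trivial, ?_, trivial, fun v _ => ?_,
      fun v _ => ?_⟩⟩
  · rintro e x y (h1 | h1)
    exacts [h.le _ _ _ h1, h1.1]
  · rintro e x y (h1 | ⟨-, h1, h2⟩) (h1' | ⟨-, h1', h2'⟩)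
    · exact h.antisymm _ _ _ h1 h1'
    · exact absurd ⟨h.right_mem _ _ _ h1, h.left_mem _ _ _ h1⟩ h1'
    · exact absurd ⟨h.right_mem _ _ _ h1', h.left_mem _ _ _ h1'⟩ h1
    · exact ((hf x y).1 (h'.antisymm _ _ _ h2 h2')).resolve_right h1
  · exact Within.lift_collapse (T := T) hf
      (fun x hx => (h.out x hx).adj_mono fun _ _ _ h => .inl h) h'.le
      (fun e x y h1 h2 h3 => .inr ⟨h2, h3, h1⟩) (h'.out (f v) trivial)
  · refine (Within.lift_collapse (T := Flip T) (P := Flip fun e x y => O e x y ∨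
      (T e x y ∧ ¬ (x ∈ W ∧ y ∈ W) ∧ O' e (f x) (f y))) (O' := Flip O') hf
      (fun x hx => (h.into x hx).flip.adj_mono fun _ _ _ h => .inl h) ?_
      (fun e x y h1 h2 h3 => .inr ⟨h2, fun h => h3 h.symm, h1⟩) (h'.into (f v) trivial).flip).flip
    intro e a b h1
    obtain ⟨x, y, h2, h3, h4⟩ := h'.le _ _ _ h1
    exact ⟨y, x, h2, h4, h3⟩

/-! ### Induction on the radius -/

/-- Here `s` is the imbalance, out minus in, accumulated by earlier collapses. Its bound is the
imbalance that the preceding stage can create, but never below 2, since the cap `2 * (r + 1)` falls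
by 2 from one stage to the next. -/
theorem exists_rootedOrientation (hm : 1 ≤ m) (r : ℕ) :
    ∀ {V : Type*} [Finite V] {T : E → V → V → Prop} {u : V} (s : ℤ), Ends T → CutConnected T →
      (∀ e x y, T e x y → OnCycle T m e) →
      (∀ v, Within (Adj T) r u v ∧ Within (Adj T) r v u) →
      |s| ≤ max 2 (min (m : ℤ) (2 * (r + 1)) - 1) →
      ∃ a b : ℕ, a + b = ∑ j ∈ Finset.range r, (3 * min m (2 * (j + 1)) - 1) ∧
        |(a : ℤ) - b + s| ≤ 2 ∧ ∃ O, IsRootedOrientation T O u a b Set.univ := by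
  induction r with
  | zero =>
    intro V _ T u s _ _ _ hr hs
    have hs2 : |s| ≤ 2 := hs.trans (by simp)
    have hu : ∀ v, v = u := fun v => (hr v).2.eq_of_zero
    refine ⟨0, 0, rfl, by simpa using hs2, fun _ _ _ => False, ?_⟩
    exact ⟨fun _ _ _ => False.elim, fun _ _ _ => False.elim, fun _ _ _ => False.elim,
      fun _ _ _ => False.elim, trivial, fun x _ => hu x ▸ .refl _ _, fun x _ => hu x ▸ .refl _ _⟩
  | succ r ih =>
    intro V _ T u s hT hcut hcyc hr hs
    set c := min m (2 * (r + 1)) with hc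
    have hc1 : 1 ≤ c := by omega
    have hcyc' : ∀ e x y, T e x y → OnCycle T c e := by
      intro e x y he
      rcases le_total m (2 * (r + 1)) with h | h
      · rw [hc, min_eq_left h]
        exact hcyc e x y he
      · rw [hc, min_eq_right h]
        exact onCycle_of_eccentricity hT hcut hr he
    have step : ∀ p q : ℕ, (∃ O W, IsRootedOrientation T O u p q W ∧
        ∀ e v, T e u v ∨ T e v u → v ∈ W) → p + q = 3 * c - 1 →
        |s + p - q| ≤ max 2 (min (m : ℤ) (2 * (r + 1)) - 1) →
        ∃ a b : ℕ, a + b = ∑ j ∈ Finset.range (r + 1), (3 * min m (2 * (j + 1)) - 1) ∧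
        |(a : ℤ) - b + s| ≤ 2 ∧ ∃ O, IsRootedOrientation T O u a b Set.univ := by
      rintro p q ⟨O, W, hO, hN⟩ hpq hs'
      obtain ⟨f, hsurj, hf⟩ := exists_collapse W
      have hfin := Finite.of_surjective f hsurj
      have hr' : ∀ v, Within (Adj (Push T f)) r (f u) v ∧ Within (Adj (Push T f)) r v (f u) := by
        intro v
        obtain ⟨v, rfl⟩ := hsurj v
        have hadj : ∀ a b, Adj T a b → Adj (Push T f) (f a) (f b) :=
          fun a b ⟨e, he⟩ => ⟨e, a, b, he, rfl, rfl⟩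
        constructor
        -- The first step from `u` stays in `W` and disappears in the quotient.
        · cases (hr v).1 with
          | refl => exact .refl _ _
          | @step _ _ w _ h p =>
            obtain ⟨e, he⟩ := h
            rw [(hf u w).2 (.inr ⟨hO.root_mem, hN e w (.inl he)⟩)]
            exact p.map f hadj
        · rcases (hr v).2.cases_tail with rfl | ⟨w, p, e, he⟩
          · exact .refl _ _
          · rw [(hf u w).2 (.inr ⟨hO.root_mem, hN e w (.inr he)⟩)]
            exact p.map f hadj
      obtain ⟨a, b, hab, hs'', O', hO'⟩ := ih (s + p - q) (hT.push f) (hcut.push hT f)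
        (by rintro e _ _ ⟨x, y, h, -, -⟩; exact (hcyc e x y h).push f) hr' hs'
      refine ⟨p + a, q + b, ?_, ?_, hO.lift_collapse hf hO'⟩
      · rw [Finset.sum_range_succ]
        omega
      · push_cast
        convert hs'' using 2
        ring
    rw [abs_le] at hs
    -- A stage changes the imbalance by `c - 1` in either direction; the sign is chosen against `s`.
    rcases le_total 0 s with h0 | h0
    · refine step c (2 * c - 1) (exists_rootedOrientation_neighbors hT u hc1 hcyc') (by omega) ?_
      rw [abs_le]
      push_cast [Nat.cast_sub (show 1 ≤ 2 * c by omega)] at hs ⊢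
      omega
    · obtain ⟨O, W, hO, hN⟩ := exists_rootedOrientation_neighbors hT.flip u hc1
        fun e x y h => (hcyc' e y x h).flip
      refine step (2 * c - 1) c ⟨Flip O, W, hO.flip, fun e v h => hN e v h.symm⟩ (by omega) ?_
      rw [abs_le]
      push_cast [Nat.cast_sub (show 1 ≤ 2 * c by omega)] at hs ⊢
      omega

end Darts
-- From mixed multigraphs to families of darts and back
section Walks

variable {V E : Type*} {G : MixedMultigraph V E}

theorem ends_traverses (G : MixedMultigraph V E) : Ends G.Traverses := by
  intro e x y x' y' h h'
  unfold Traverses at h h'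
  rcases h with h | h <;> rcases h' with h' | h' <;> rw [h] at h'
  · rcases Sym2.eq_iff.1 (Sum.inl.inj h') with ⟨rfl, rfl⟩ | ⟨rfl, rfl⟩
    exacts [.inl ⟨rfl, rfl⟩, .inr ⟨rfl, rfl⟩]
  · cases h'
  · cases h'
  · have := Prod.mk.inj (Sum.inr.inj h')
    exact .inl ⟨this.1.symm, this.2.symm⟩

theorem exists_traverses (G : MixedMultigraph V E) (e : E) : ∃ x y, G.Traverses e x y := by
  rcases h : G.edge e with s | ⟨x, y⟩
  · induction s with
    | _ x y => exact ⟨x, y, .inl h⟩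
  · exact ⟨x, y, .inr h⟩

namespace Walk

theorem within_avoid {u v : V} {e : E} (p : G.Walk u v) (he : e ∉ p.edges) :
    Within (Adj (Avoid G.Traverses e)) p.length u v := by
  induction p with
  | nil u => exact .refl _ _
  | cons f h p ih =>
    simp only [edges, List.mem_cons, not_or] at he
    exact .step ⟨f, h, Ne.symm he.1⟩ (ih he.2)

theorem within {u v : V} (p : G.Walk u v) : Within (Adj G.Traverses) p.length u v := by
  induction p with
  | nil u => exact .refl _ _
  | cons f h p ih => exact .step ⟨f, h⟩ ih

theorem IsTrail.exists_split {u v : V} {e : E} {p : G.Walk u v} (hp : p.IsTrail)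
    (he : e ∈ p.edges) : ∃ x y i j, G.Traverses e x y ∧
      Within (Adj (Avoid G.Traverses e)) i u x ∧ Within (Adj (Avoid G.Traverses e)) j y v ∧
      i + j + 1 = p.length := by
  induction p with
  | nil u => simp [edges] at he
  | @cons u w v f h p ih =>
    simp only [IsTrail, edges, List.nodup_cons] at hp ih
    simp only [edges, List.mem_cons] at he
    by_cases hef : e = f
    · subst hef
      exact ⟨u, w, 0, p.length, h, .refl _ _, p.within_avoid hp.1, by simp [length]⟩
    · obtain ⟨x, y, i, j, h1, h2, h3, h4⟩ := ih hp.2 (he.resolve_left hef)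
      exact ⟨x, y, i + 1, j, h1, .step ⟨f, h, Ne.symm hef⟩ h2, h3, by simp only [length]; omega⟩

theorem start_mem_support {u v : V} (p : G.Walk u v) : u ∈ p.support := by
  cases p <;> simp [support]

theorem exists_support_eq {u v : V} (p : G.Walk u v) : ∃ l, p.support = l ++ [v] := by
  induction p with
  | nil u => exact ⟨[], rfl⟩
  | @cons u w v f h p ih =>
    obtain ⟨l, hl⟩ := ih
    exact ⟨u :: l, by simp [support, hl]⟩

theorem mem_support_of_mem_edges {u v x y : V} {e : E} (p : G.Walk u v) (he : e ∈ p.edges)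
    (h : G.Traverses e x y) : x ∈ p.support := by
  induction p with
  | nil u => simp [edges] at he
  | @cons u w v f hf p ih =>
    simp only [edges, List.mem_cons] at he
    simp only [support, List.mem_cons]
    rcases he with rfl | he
    · rcases ends_traverses G _ _ _ _ _ hf h with ⟨rfl, rfl⟩ | ⟨rfl, rfl⟩
      exacts [.inl rfl, .inr p.start_mem_support]
    · exact .inr (ih he)

theorem isTrail_of_nodup_support {u v : V} (p : G.Walk u v) (hp : p.support.Nodup) :
    p.IsTrail := by
  unfold IsTrail
  induction p with
  | nil u => simp [edges]
  | cons f h p ih =>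
    simp only [support, List.nodup_cons] at hp
    simp only [edges, List.nodup_cons]
    exact ⟨fun hf => hp.1 (p.mem_support_of_mem_edges hf h), ih hp.2⟩

theorem isPath_of_nodup_support {u v : V} (p : G.Walk u v) (hp : p.support.Nodup) : p.IsPath :=
  ⟨p.isTrail_of_nodup_support hp, hp.sublist (List.dropLast_sublist _),
    hp.sublist (List.tail_sublist _)⟩

theorem exists_suffix {u v w : V} (p : G.Walk u v) (hp : p.support.Nodup) (hw : w ∈ p.support) :
    ∃ q : G.Walk w v, q.support.Nodup ∧ q.length ≤ p.length ∧ q.edges ⊆ p.edges := by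
  induction p with
  | nil u =>
    obtain rfl : w = u := by simpa [support] using hw
    exact ⟨nil w, hp, le_rfl, fun _ h => h⟩
  | @cons u x v f h p ih =>
    by_cases hwu : w = u
    · subst hwu
      exact ⟨cons f h p, hp, le_rfl, fun _ h => h⟩
    · simp only [support, List.nodup_cons, List.mem_cons] at hp hw
      obtain ⟨q, h1, h2, h3⟩ := ih hp.2 (hw.resolve_left hwu)
      exact ⟨q, h1, h2.trans (Nat.le_succ _), fun _ h => List.mem_cons_of_mem _ (h3 h)⟩

end Walk

/-- Whenever a new first vertex is already on the walk, the loop is cut off. -/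
theorem Within.exists_walk {P : E → Prop} {n : ℕ} {u v : V}
    (h : Within (Adj fun e x y => G.Traverses e x y ∧ P e) n u v) :
    ∃ p : G.Walk u v, p.support.Nodup ∧ p.length ≤ n ∧ ∀ e ∈ p.edges, P e := by
  induction h with
  | refl n x => exact ⟨.nil x, by simp [Walk.support], Nat.zero_le _, by simp [Walk.edges]⟩
  | @step n x y z h _ ih =>
    obtain ⟨e, he, hP⟩ := h
    obtain ⟨p, h1, h2, h3⟩ := ih
    by_cases hx : x ∈ p.support
    · obtain ⟨q, h4, h5, h6⟩ := p.exists_suffix h1 hx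
      exact ⟨q, h4, by omega, fun e he => h3 e (h6 he)⟩
    · refine ⟨.cons e he p, by simp [Walk.support, hx, h1], by simp only [Walk.length]; omega, ?_⟩
      intro f hf
      rcases List.mem_cons.1 hf with rfl | hf
      exacts [hP, h3 f hf]

theorem dist_le_iff {u v : V} {n : ℕ} :
    G.dist u v ≤ n ↔ Within (Adj G.Traverses) n u v := by
  constructor
  · intro h
    have h' : G.dist u v < ((n + 1 : ℕ) : ℕ∞) := h.trans_lt (by exact_mod_cast Nat.lt_succ_self n)
    obtain ⟨p, hp⟩ := iInf_lt_iff.1 h'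
    have hp : p.1.length < n + 1 := by exact_mod_cast hp
    exact p.1.within.mono (by omega)
  · intro h
    obtain ⟨p, h1, h2, -⟩ := Within.exists_walk (P := fun _ => True)
      (h.adj_mono fun _ _ _ h => ⟨h, trivial⟩)
    exact (iInf_le _ ⟨p, p.isPath_of_nodup_support h1⟩).trans (by exact_mod_cast h2)

theorem eccentricity_le_iff {u : V} {a b : ℕ} :
    (G.outEccentricity u ≤ a ∧ G.inEccentricity u ≤ b) ↔
      ∀ v, Within (Adj G.Traverses) a u v ∧ Within (Adj G.Traverses) b v u := by
  simp only [outEccentricity, inEccentricity, iSup_le_iff, dist_le_iff, forall_and]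

theorem EveryEdgeOnCycle.onCycle {k : ℕ} (h : G.EveryEdgeOnCycle k) (e : E) :
    OnCycle G.Traverses (k - 1) e := by
  obtain ⟨u, c, hc, he, hk⟩ := h e
  obtain ⟨x, y, i, j, h1, h2, h3, h4⟩ := hc.1.1.exists_split he
  exact ⟨x, y, h1, (h3.trans h2).mono (by omega)⟩

theorem everyEdgeOnCycle_of_onCycle {k : ℕ} (h : ∀ e, OnCycle G.Traverses k e) :
    G.EveryEdgeOnCycle (k + 1) := by
  intro e
  obtain ⟨x, y, he, p⟩ := h e
  obtain ⟨q, h1, h2, h3⟩ := p.exists_walk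
  refine ⟨x, .cons e he q, ⟨⟨?_, ?_, ?_⟩, Nat.succ_pos _⟩, List.mem_cons_self,
    Nat.succ_le_succ h2⟩
  · exact List.nodup_cons.2 ⟨fun h => h3 e h rfl, q.isTrail_of_nodup_support h1⟩
  · obtain ⟨l, hl⟩ := q.exists_support_eq
    rw [hl] at h1
    have : (Walk.cons e he q).support.dropLast = x :: l := by
      rw [Walk.support, hl, ← List.cons_append, List.dropLast_concat]
    rw [this]
    exact (List.perm_append_singleton x l).nodup_iff.1 h1
  · exact h1

theorem Walk.exists_crossing {u v : V} (p : G.Walk u v) (A : Set V) (hu : u ∈ A) (hv : v ∉ A) :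
    ∃ e, ∃ a ∈ A, ∃ b ∉ A, G.Traverses e a b := by
  induction p with
  | nil u => exact absurd hu hv
  | @cons u w v e h p ih =>
    by_cases hw : w ∈ A
    exacts [ih hw hv, ⟨e, u, hu, w, hw, h⟩]

/-- A walk joining the two ends after removal of `e` must cross the cut. -/
theorem Bridgeless.cutConnected (h : G.Bridgeless) : CutConnected G.Traverses := by
  intro e x y hxy hyx A hx hy
  have hne : x ≠ y := fun h => hy (h ▸ hx)
  have hund : ∃ s : Sym2 V, G.edge e = Sum.inl s := by
    rcases hxy with h1 | h1
    · exact ⟨_, h1⟩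
    rcases hyx with h2 | h2
    · exact ⟨_, h2⟩
    · rw [h1] at h2
      exact absurd (Prod.mk.inj (Sum.inr.inj h2)).1 hne
  have hconn := not_not.1 fun hc => h e ⟨hund, hc⟩
  obtain ⟨p, -⟩ := hconn x y hne
  obtain ⟨f, a, ha, b, hb, hf⟩ := p.exists_crossing A hx hy
  refine ⟨f.1, f.2, a, ha, b, hb, ?_⟩
  unfold Traverses underlying deleteEdge at hf
  unfold Traverses
  rcases hG : G.edge f.1 with s | ⟨c, d⟩ <;> simp only [hG] at hf
  · rcases hf with hf | hf
    · exact .inl (.inl hf)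
    · cases hf
  · rcases hf with hf | hf
    · rcases Sym2.eq_iff.1 (Sum.inl.inj hf) with ⟨rfl, rfl⟩ | ⟨rfl, rfl⟩
      exacts [.inl (.inr rfl), .inr (.inr rfl)]
    · cases hf

/-- Edges unused by `O` get any admissible direction; extra darts never lengthen distances. -/
theorem IsRootedOrientation.orientedRadius_le {O : E → V → V → Prop} {u : V} {a b : ℕ}
    (h : IsRootedOrientation G.Traverses O u a b Set.univ) :
    G.orientedRadius ≤ ((max a b : ℕ) : ℕ∞) := by
  have hex : ∀ e, ∃ q : V × V, G.Traverses e q.1 q.2 ∧ ∀ x y, O e x y → q = (x, y) := by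
    intro e
    by_cases he : ∃ x y, O e x y
    · obtain ⟨x, y, hxy⟩ := he
      refine ⟨(x, y), h.le _ _ _ hxy, fun x' y' h' => ?_⟩
      rcases ends_traverses G _ _ _ _ _ (h.le _ _ _ hxy) (h.le _ _ _ h') with ⟨rfl, rfl⟩ | ⟨rfl, rfl⟩
      · rfl
      · rw [h.antisymm _ _ _ h' hxy]
    · obtain ⟨x, y, hxy⟩ := G.exists_traverses e
      exact ⟨(x, y), hxy, fun x' y' h' => absurd ⟨x', y', h'⟩ he⟩
  choose q hq hq' using hex
  set D : MixedMultigraph V E := ⟨fun e => Sum.inr (q e)⟩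
  have hD : D.IsOrientation G := fun e => ⟨(q e).1, (q e).2, rfl, hq e⟩
  have hOD : ∀ e x y, O e x y → D.Traverses e x y :=
    fun e x y h => .inr (congrArg Sum.inr (hq' e x y h))
  have hecc := (eccentricity_le_iff (G := D) (u := u) (a := a) (b := b)).2 fun v =>
    ⟨(h.out v trivial).adj_mono hOD, (h.into v trivial).adj_mono hOD⟩
  have h1 : G.orientedRadius ≤ D.radius :=
    iInf_le (fun D : {D : MixedMultigraph V E // D.IsOrientation G} => D.1.radius) ⟨D, hD⟩
  have h2 : D.radius ≤ D.eccentricity u := iInf_le _ u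
  refine h1.trans (h2.trans (max_le (hecc.1.trans ?_) (hecc.2.trans ?_)))
  exacts [Nat.cast_le.2 (le_max_left a b), Nat.cast_le.2 (le_max_right a b)]

end Walks

/-! ### Estimating the sum of the stage costs -/

theorem sum_min_eq {m : ℕ} : ∀ {r : ℕ}, 2 * r ≤ m →
    ((∑ j ∈ Finset.range r, (3 * min m (2 * (j + 1)) - 1) : ℕ) : ℤ) = 3 * (r * (r + 1)) - r
  | 0, _ => by simp
  | r + 1, h => by
    rw [Finset.sum_range_succ, Nat.cast_add, sum_min_eq (by omega), min_eq_right (by omega),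
      Nat.cast_sub (by omega)]
    push_cast
    ring

/-- The minimum changes from `2 * (j + 1)` to `m` near `j = m / 2`. For even `m` the bound is an
equality; for odd `m` the slack is 3. -/
theorem sum_min_le {m : ℕ} (hm : 1 ≤ m) : ∀ {r : ℕ}, m ≤ 2 * r →
    4 * ((∑ j ∈ Finset.range r, (3 * min m (2 * (j + 1)) - 1) : ℕ) : ℤ) ≤
      3 * (4 * r * m - m * (m - 2)) - 4 * r
  | 0, h => by omega
  | r + 1, h => by
    rw [Finset.sum_range_succ, Nat.cast_add, Nat.cast_sub (by omega)]
    push_cast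
    rcases Nat.lt_or_ge (2 * r) m with h' | h'
    · have := sum_min_eq (r := r) h'.le
      push_cast at this
      rw [this]
      obtain rfl | rfl : m = 2 * r + 1 ∨ m = 2 * r + 2 := by omega
      · rw [min_eq_left (by push_cast; omega)]
        push_cast
        linarith
      · rw [min_eq_left (by push_cast; omega)]
        push_cast
        linarith
    · have := sum_min_le hm h'
      push_cast at this
      rw [min_eq_left (by omega)]
      linarith

end MixedMultigraph

/-! ### The theorem -/

open MixedMultigraph in
theorem theorem2 {V E : Type*} [Finite V] [Finite E] (G : MixedMultigraph V E) (r : ℕ)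
    (hr : 1 ≤ r) (hconn : G.StronglyConnected) (hbridge : G.Bridgeless)
    (hrad : G.radius = (r : ℕ∞)) :
    IsLeast {k : ℕ | G.EveryEdgeOnCycle k} G.eta ∧
    (∃ ρ : ℕ, G.orientedRadius = (ρ : ℕ∞) ∧
      (ρ : ℝ) ≤ 1.5 * (r : ℝ) * (G.eta : ℝ)
        - 0.375 * ((G.eta : ℝ) - 1) * ((G.eta : ℝ) - 3) - 2 * (r : ℝ) + 1) ∧
    1.5 * (r : ℝ) * (G.eta : ℝ)
        - 0.375 * ((G.eta : ℝ) - 1) * ((G.eta : ℝ) - 3) - 2 * (r : ℝ) + 1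
      ≤ 1.5 * (r : ℝ) * (G.eta : ℝ) := by
  have hr1 : (1 : ℝ) ≤ r := by exact_mod_cast hr
  have hT := ends_traverses G
  have hcut := hbridge.cutConnected
  obtain ⟨u, hu⟩ : ∃ u, G.eccentricity u < ((r + 1 : ℕ) : ℕ∞) :=
    iInf_lt_iff.1 (hrad.trans_lt (by exact_mod_cast Nat.lt_succ_self r))
  have hu : G.eccentricity u ≤ r := by
    rw [Nat.cast_add, Nat.cast_one] at hu
    exact ENat.lt_add_one_iff (ENat.natCast_ne_top r) |>.1 hu
  have hecc : ∀ v, Within (Adj G.Traverses) r u v ∧ Within (Adj G.Traverses) r v u :=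
    eccentricity_le_iff.1 (max_le_iff.1 hu)
  have hcyc : G.EveryEdgeOnCycle (2 * r + 1) := everyEdgeOnCycle_of_onCycle fun e => by
    obtain ⟨x, y, he⟩ := G.exists_traverses e
    exact onCycle_of_eccentricity hT hcut hecc he
  have hmem : G.EveryEdgeOnCycle G.eta := Nat.sInf_mem (s := {k | G.EveryEdgeOnCycle k}) ⟨_, hcyc⟩
  have hle : G.eta ≤ 2 * r + 1 := Nat.sInf_le hcyc
  -- If `η ≤ 1`, every edge is a loop and the radius is 0. Hence `m = η - 1` is positive.
  have heta : 2 ≤ G.eta := by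
    by_contra hlt
    have hloop : ∀ a b, Adj G.Traverses a b → a = b := by
      rintro a b ⟨e, he⟩
      obtain ⟨x, y, hxy, p⟩ := hmem.onCycle e
      obtain rfl := (p.mono (by omega : G.eta - 1 ≤ 0)).eq_of_zero
      rcases hT _ _ _ _ _ he hxy with ⟨rfl, rfl⟩ | ⟨rfl, rfl⟩ <;> rfl
    have hall : ∀ n a b, Within (Adj G.Traverses) n a b → a = b := by
      intro n a b h
      induction h with
      | refl => rfl
      | step h _ ih => exact (hloop _ _ h).trans ih
    have h0 := (eccentricity_le_iff (G := G) (u := u) (a := 0) (b := 0)).2 fun v =>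
      hall _ _ _ (hecc v).1 ▸ ⟨.refl _ _, .refl _ _⟩
    have : G.radius ≤ (0 : ℕ) := (iInf_le _ u).trans (max_le h0.1 h0.2)
    rw [hrad] at this
    have : r ≤ 0 := by exact_mod_cast this
    omega
  refine ⟨⟨hmem, fun k hk => Nat.sInf_le hk⟩, ?_, ?_⟩
  · obtain ⟨m, hm⟩ : ∃ m, G.eta = m + 1 := ⟨G.eta - 1, by omega⟩
    obtain ⟨a, b, hab, habs, O, hO⟩ := exists_rootedOrientation (m := m) (by omega) r 0 hT hcut
      (fun e _ _ _ => by simpa [hm] using hmem.onCycle e) hecc (by simp)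
    have hrho := hO.orientedRadius_le
    obtain ⟨ρ, hρ⟩ := ENat.ne_top_iff_exists.1 (ne_top_of_le_ne_top (ENat.natCast_ne_top _) hrho)
    refine ⟨ρ, hρ.symm, ?_⟩
    rw [← hρ] at hrho
    have hρab : ρ ≤ max a b := by exact_mod_cast hrho
    have hsum := sum_min_le (m := m) (by omega) (r := r) (by omega)
    rw [← hab] at hsum
    rw [abs_le] at habs
    -- The larger of `a` and `b` exceeds their mean by at most 1, as they differ by at most 2.
    have h2 : 2 * (ρ : ℤ) ≤ a + b + 2 := by omega
    have h2' : 2 * (ρ : ℝ) ≤ a + b + 2 := by exact_mod_cast h2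
    have hsum' : 4 * ((a : ℝ) + b) ≤ 3 * (4 * r * m - m * (m - 2)) - 4 * r := by
      exact_mod_cast hsum
    rw [hm]
    push_cast
    linarith
  · have h2 : (2 : ℝ) ≤ G.eta := by exact_mod_cast heta
    nlinarith [sq_nonneg ((G.eta : ℝ) - 2)]
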